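/- Let $k$ be a field of characteristic zero and let $H=S(V)$ be a conilpotent right-handed polynomial Hopf algebra over $k$: the algebra $H$ is the polynomial (symmetric) algebra over a vector space $V$, it is a Hopf algebra whose counit is the projection $S(V)\to S^0(V)=k$, the reduced coproduct $\overline\Delta(c)=\Delta(c)-c\otimes 1-1\otimes c$ satisfies $\overline\Delta(V)\subset V\otimes S(V)$, and every $c$ in the kernel of the counit is annihilated by some iterated reduced coproduct $\overline\Delta^{[n]}$, where $\overline\Delta^{[1]}=\mathrm{id}$ and $\overline\Delta^{[n+1]}=(\mathrm{id}\otimes\overline\Delta^{[n]})\circ\overline\Delta$. Let $(b_i)_{i\in X}$ be a basis of $V$ indexed by a totally ordered set $X$ (for instance $X=\{1,\dots,n\}$ or $X=\mathbf N^*$). For a finite multiset $I$ over $X$ put $b_I=\prod_{i\in I}b_i$, and define the coefficients $\lambda^{i;i_0}_I\in k$ by $$\overline\Delta(b_i)=\sum_{i_0,\;I\neq\emptyset}\lambda^{i;i_0}_I\, b_{i_0}\otimes b_I .$$ The set $\mathcal T_i$ of trees associated to $b_i$ is defined inductively: it consists of the one-vertex tree $\bullet_i$, and of the trees $T=B^+_{(i;i_0)}(T_1,\dots,T_s)$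 with $s\ge 1$, $i_0\in X$, obtained by adding a common root decorated by $(i;i_0)$ to a family of trees $T_1\in\mathcal T_{i_1},\dots,T_s\in\mathcal T_{i_s}$, where $i_1\le\dots\le i_s$. (Thus the branches at a vertex form a family indexed by the standard enumeration of the multiset $\{i_1,\dots,i_s\}$; families that differ by a permutation of branches whose roots have the same first decoration count as different elements.) Put $\lambda(\bullet_i)=1$, $v(\bullet_i)=b_i$ and, for $T$ as above, with $I=\{i_1,\dots,i_s\}$ (a multiset), $$\lambda(T)=\lambda^{i;i_0}_{I}\,\lambda(T_1)\cdots\lambda(T_s),\qquad v(T)=b_{i_0}\,v(T_1)\cdots v(T_s).$$ View $T$ as the poset of its vertices, with the root as minimum. For $n\ge 1$, let $n\text{-lin}(T)$ be the set of surjective maps $f:T\to\{1,\dots,n\}$ such that $x<y$ implies $f(x)<f(y)$. Let $\ast$ be the convolution product on linear endomorphisms of $H$, $\varepsilon$ its unit, and $S$ the antipode of $H$. Then for every $i\in X$: 1. For every $n\ge1$, only finitely many $T\in\mathcal T_i$ satisfy both $\lambda(T)\ne0$ and $n\text{-lin}(T)\neq\emptyset$, and $$(\mathrm{id}-\varepsilon)^{\ast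 n}(b_i)=\sum_{T\in\mathcal T_i}\ \sum_{f\in n\text{-lin}(T)}\lambda(T)\,v(T).$$ 2. The inner double sums below vanish for all but finitely many $n$, and $$S(b_i)=\sum_{n\ge1}\Bigl(\sum_{T\in\mathcal T_i}\ \sum_{f\in n\text{-lin}(T)}(-1)^n\lambda(T)\,v(T)\Bigr).$$ -/

import Mathlib

open scoped TensorProduct

noncomputable section

namespace PreLieForest

section HopfAlgebra

variable (k : Type*) [Field k] {V H : Type*} [AddCommGroup V] [Module k V] [CommRing H]

/-- The reduced coproduct `c ↦ Δ c - c ⊗ 1 - 1 ⊗ c`. -/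
def reducedComul (H : Type*) [CommRing H] [Bialgebra k H] : H →ₗ[k] H ⊗[k] H :=
  Coalgebra.comul - (TensorProduct.mk k H H).flip 1 - TensorProduct.mk k H H 1

/-- The iterated reduced coproducts. The value at `n` is the map to `H ^ ⊗ (n + 1)` given by the
identity for `n = 0` and by `(id ⊗ (n-th iterate)) ∘ (reduced coproduct)` afterwards, where
`H ^ ⊗ (n + 1)` is viewed as a homogeneous component of the tensor algebra over `H`. -/
def iteratedReducedComul (H : Type*) [CommRing H] [Bialgebra k H] :
    ℕ → (H →ₗ[k] TensorAlgebra k H)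
  | 0 => TensorAlgebra.ι k
  | n + 1 =>
    LinearMap.mul' k (TensorAlgebra k H) ∘ₗ
      TensorProduct.map (TensorAlgebra.ι k) (iteratedReducedComul H n) ∘ₗ reducedComul k H

/-- Conilpotency: every element of the kernel of the counit is annihilated by some iterated
reduced coproduct. -/
def IsConilpotent (H : Type*) [CommRing H] [Bialgebra k H] : Prop :=
  ∀ c : H, Coalgebra.counit (R := k) c = 0 → ∃ n : ℕ, iteratedReducedComul k H n c = 0

variable {k}

/-- `ι : V → H` exhibits the bialgebra `H` as a right-handed polynomial bialgebra over `V`: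
`H` is the polynomial algebra `S(V)`, the counit is the projection onto `S⁰(V) = k`, and the
reduced coproduct maps `V` to `V ⊗ S(V)`. -/
structure IsRightHandedPolynomial [Bialgebra k H] (ι : V →ₗ[k] H) : Prop where
  isSymmetricAlgebra : IsSymmetricAlgebra ι
  counit_ι : ∀ v : V, Coalgebra.counit (R := k) (ι v) = 0
  reducedComul_mem : ∀ v : V, reducedComul k H (ι v) ∈ LinearMap.range (ι.rTensor H)

section Monomials

variable {X : Type*} [DecidableEq X] [Algebra k H] {ι : V →ₗ[k] H}

/-- The basis of monomials `b_I` of `H = S(V)`, indexed by the finite multisets `I` over `X`. -/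
def monomialBasis (h : IsSymmetricAlgebra ι) (b : Module.Basis X k V) :
    Module.Basis (Multiset X) k H :=
  (b.symmetricAlgebra.map h.equiv.toLinearEquiv).reindex Multiset.toFinsupp.symm.toEquiv

theorem monomialBasis_apply (h : IsSymmetricAlgebra ι) (b : Module.Basis X k V)
    (I : Multiset X) : monomialBasis h b I = (I.map fun i => ι (b i)).prod := by
  have key : ∀ p : MvPolynomial X k,
      h.equiv ((SymmetricAlgebra.equivMvPolynomial b).symm p) =
        MvPolynomial.aeval (fun i => ι (b i)) p := by
    intro p
    induction p using MvPolynomial.induction_on with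
    | C a =>
      rw [← MvPolynomial.algebraMap_eq, AlgEquiv.commutes, AlgEquiv.commutes, AlgHom.commutes]
    | add p q hp hq => simp only [map_add, hp, hq]
    | mul_X p i hp =>
      rw [map_mul, map_mul, hp, SymmetricAlgebra.equivMvPolynomial_symm_X, map_mul]
      simp
  have : monomialBasis h b I = h.equiv ((SymmetricAlgebra.equivMvPolynomial b).symm
      (MvPolynomial.monomial (Multiset.toFinsupp I) 1)) := by
    simp [monomialBasis, Module.Basis.symmetricAlgebra]
  rw [this, key, MvPolynomial.aeval_monomial]
  simp [Finsupp.prod, Finset.prod_multiset_map_count]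

end Monomials

/-- The structure coefficient `λ^{i; i₀}_I`: the coefficient of `b_{i₀} ⊗ b_I` in the expansion of
the reduced coproduct of `b_i` on the basis of tensor products of monomials. -/
def structureCoeff {X : Type*} [DecidableEq X] [Bialgebra k H] {ι : V →ₗ[k] H}
    (h : IsSymmetricAlgebra ι) (b : Module.Basis X k V) (i i₀ : X) (I : Multiset X) : k :=
  ((monomialBasis h b).tensorProduct (monomialBasis h b)).repr
    (reducedComul k H (ι (b i))) ({i₀}, I)

end HopfAlgebra

/-- `n`-linearizations of a poset `P`: the surjective maps from `P` to `[n]` that preserve strict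
inequalities. -/
def Linearization (P : Type*) [PartialOrder P] (n : ℕ) : Type _ :=
  {f : P → Fin n // Function.Surjective f ∧ StrictMono f}

instance (P : Type*) [PartialOrder P] [Finite P] (n : ℕ) : Fintype (Linearization P n) :=
  have : Finite (Linearization P n) := inferInstanceAs (Finite {f : P → Fin n // Function.Surjective f ∧ StrictMono f})
  Fintype.ofFinite _

/-- Finite rooted trees whose leaves are decorated by elements of `X` and whose internal vertices
are decorated by pairs of elements of `X`. `leaf i` is the tree with one vertex decorated by `i`,
and `node i i₀ s T` is the tree obtained by adding a common root decorated by `(i; i₀)` to the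
`s + 1` trees `T 0, …, T s`. -/
inductive DecTree (X : Type*) : Type _
  | leaf (i : X) : DecTree X
  | node (i i₀ : X) (s : ℕ) (T : Fin (s + 1) → DecTree X) : DecTree X

namespace DecTree

variable {X : Type*}

/-- The (first) decoration of the root. -/
def root : DecTree X → X
  | leaf i => i
  | node i _ _ _ => i

/-- At each internal vertex, the subtrees `T 0, …, T s` attached to it are listed in weakly
increasing order of their root decorations `i_0 ≤ … ≤ i_s`. In other words, the branches at a vertex
form a family indexed by the canonical enumeration of a multiset of decorations. -/
def Sorted [LinearOrder X] : DecTree X → Prop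
  | leaf _ => True
  | node _ _ _ T => (Monotone fun j => (T j).root) ∧ ∀ j, (T j).Sorted

/-- The set `𝒯_i` of trees associated to `b_i`. -/
def treesAt [LinearOrder X] (i : X) : Set (DecTree X) :=
  {T | T.Sorted ∧ T.root = i}

/-- The vertices of a tree: for `node i i₀ s T`, the root (written `⊥`) and the vertices of the
trees `T j`. -/
def Vertex : DecTree X → Type
  | leaf _ => Unit
  | node _ _ s T => WithBot (Σ j : Fin (s + 1), (T j).Vertex)

/-- The tree order: the root is the minimum, and vertices in different branches are
incomparable (the order on `Σ` is the disjoint sum of orders). -/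
instance instPartialOrderVertex : (T : DecTree X) → PartialOrder T.Vertex
  | leaf _ => inferInstanceAs (PartialOrder Unit)
  | node _ _ s T =>
    letI (j : Fin (s + 1)) : PartialOrder (T j).Vertex := instPartialOrderVertex (T j)
    inferInstanceAs (PartialOrder (WithBot (Σ j : Fin (s + 1), (T j).Vertex)))

instance instFintypeVertex : (T : DecTree X) → Fintype T.Vertex
  | leaf _ => inferInstanceAs (Fintype Unit)
  | node _ _ s T =>
    letI (j : Fin (s + 1)) : Fintype (T j).Vertex := instFintypeVertex (T j)
    inferInstanceAs (Fintype (Option (Σ j : Fin (s + 1), (T j).Vertex)))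

/-- The second decoration `d₂` of the vertices; for a leaf, its only decoration. -/
def d₂ : (T : DecTree X) → T.Vertex → X
  | leaf i => fun _ => i
  | node _ i₀ s T =>
    WithBot.recBotCoe (C := fun _ : WithBot (Σ j : Fin (s + 1), (T j).Vertex) => X) i₀
      fun x => (T x.1).d₂ x.2

variable {k V H : Type*} [Field k] [AddCommGroup V] [Module k V] [CommRing H]
  [Bialgebra k H] {ι : V →ₗ[k] H}

/-- The coefficient `λ(T)`. -/
def coeff [DecidableEq X] (h : IsSymmetricAlgebra ι) (b : Module.Basis X k V) : DecTree X → k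
  | leaf _ => 1
  | node i i₀ _ T =>
    structureCoeff h b i i₀ (Finset.univ.val.map fun j => (T j).root) * ∏ j, coeff h b (T j)

/-- The `b`-value `v(T) = ∏_{x ∈ T} b_{d₂(x)}`. -/
def value (ι : V →ₗ[k] H) (b : Module.Basis X k V) (T : DecTree X) : H :=
  ∏ x : T.Vertex, ι (b (T.d₂ x))

end DecTree

end PreLieForest

end

/-! The proof computes the convolution powers of `id` and deduces those of J = `id - ε`. As H is
commutative, `id ^ m` is an algebra map, so right-handedness gives a recursion in m
(`id_pow_succ_basis`): passing from m to m + 1 adds to the value at b_i the element b_i and the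
terms λ b_{i₀} ∏ (`id ^ m`)(b_{i_j}). The number of strictly increasing maps from a tree to a chain
of m elements obeys the same recursion (`strictCount_node_succ`), according to whether the root
takes the least value. Hence `id_pow_basis_eq_sum`: `id ^ m` is the sum over trees weighted by these
counts. Factoring a strict map through its image gives binomial coefficients times numbers of
linearizations (`strictCount_eq_sum`), while `id ^ m` = (1 + J)^m gives the same binomials times
powers of J. Binomial inversion yields the first claim (`augProj_pow_basis`). For the second, the
antipode is the inverse of 1 + J, and its geometric series at b_i terminates by conilpotency
(`antipode_apply_eq_sum`). -/

namespace PreLieForest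

/-! ### Convolution powers, conilpotency and the antipode. -/

section Convolution

open WithConv

variable {k H : Type*} [Field k] [CommRing H]

section Bialgebra

variable [Bialgebra k H]

variable (k H) in
/-- The projection `id - ε` onto the augmentation ideal, as an element of the convolution
algebra. -/
noncomputable abbrev augProj : WithConv (H →ₗ[k] H) := toConv LinearMap.id - 1

theorem augProj_one : augProj k H 1 = 0 := by
  change (1 : H) - (1 : WithConv (H →ₗ[k] H)) 1 = 0
  simp

theorem conv_mul_one (f g : WithConv (H →ₗ[k] H)) : (f * g) 1 = f 1 * g 1 := by
  simp [LinearMap.convMul_apply, Algebra.TensorProduct.one_def]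

theorem comul_eq_reducedComul_add (c : H) :
    Coalgebra.comul (R := k) c = reducedComul k H c + c ⊗ₜ[k] 1 + 1 ⊗ₜ[k] c := by
  simp only [reducedComul, LinearMap.sub_apply, LinearMap.flip_apply, TensorProduct.mk_apply]
  abel

theorem conv_mul_apply_of_map_one {f g : WithConv (H →ₗ[k] H)} (hf : f 1 = 0) (hg : g 1 = 0)
    (c : H) :
    (f * g) c = LinearMap.mul' k H (TensorProduct.map f.ofConv g.ofConv (reducedComul k H c)) := by
  have hf' : f.ofConv 1 = 0 := hf
  have hg' : g.ofConv 1 = 0 := hg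
  rw [LinearMap.convMul_apply, comul_eq_reducedComul_add]
  simp [hf', hg']

/-- The linear map `x ↦ (J x, g x; 0, 0)`. The upper right entry of its multiplicative extension
to the tensor algebra sends `x₁ ⋯ xₙ y` to `J x₁ ⋯ J xₙ g y`. -/
def upperRow (f g : H →ₗ[k] H) : H →ₗ[k] Matrix (Fin 2) (Fin 2) H where
  toFun x := !![f x, g x; 0, 0]
  map_add' x y := by ext i j; fin_cases i <;> fin_cases j <;> simp
  map_smul' a x := by ext i j; fin_cases i <;> fin_cases j <;> simp

/-- Matrices with zero bottom row form a right ideal, and each tensor has at least one factor. -/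
theorem lift_upperRow_iteratedReducedComul_row_one (f g : H →ₗ[k] H) (n : ℕ) (c : H) :
    TensorAlgebra.lift k (upperRow f g) (iteratedReducedComul k H n c) 1 1 = 0 := by
  cases n with
  | zero => simp [iteratedReducedComul, upperRow]
  | succ n =>
    simp only [iteratedReducedComul, LinearMap.comp_apply]
    induction reducedComul k H c using TensorProduct.induction_on with
    | zero => simp
    | tmul x y => simp [upperRow, Matrix.mul_apply]
    | add x y hx hy => simp [hx, hy]

/-- Iterated coproducts live in the tensor algebra, so J ⊗ ⋯ ⊗ J ⊗ g, with its distinguished last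
factor, is evaluated through an algebra map to matrices. Vanishing at 1 lets the reduced coproduct
replace the full one. -/
theorem augProj_pow_mul_apply {g : WithConv (H →ₗ[k] H)} (hg : g 1 = 0) (n : ℕ) (c : H) :
    (augProj k H ^ n * g) c =
      TensorAlgebra.lift k (upperRow (augProj k H).ofConv g.ofConv)
        (iteratedReducedComul k H n c) 0 1 := by
  induction n generalizing c with
  | zero => simp [iteratedReducedComul, upperRow]
  | succ n ih =>
    rw [pow_succ', mul_assoc, conv_mul_apply_of_map_one augProj_one
      (by rw [conv_mul_one, hg, mul_zero])]
    simp only [iteratedReducedComul, LinearMap.comp_apply]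
    induction reducedComul k H c using TensorProduct.induction_on with
    | zero => simp
    | tmul x y =>
      have := lift_upperRow_iteratedReducedComul_row_one (augProj k H).ofConv g.ofConv n y
      rw [TensorProduct.map_tmul, TensorProduct.map_tmul, LinearMap.mul'_apply,
        LinearMap.mul'_apply, map_mul, Matrix.mul_apply, Fin.sum_univ_two, this, mul_zero,
        add_zero, ← ih, TensorAlgebra.lift_ι_apply]
      rfl
    | add x y hx hy => simp only [map_add, hx, hy, Matrix.add_apply]

theorem augProj_pow_mul_apply_eq_zero {g : WithConv (H →ₗ[k] H)} (hg : g 1 = 0) {n : ℕ} {c : H}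
    (hc : iteratedReducedComul k H n c = 0) : (augProj k H ^ n * g) c = 0 := by
  rw [augProj_pow_mul_apply hg, hc]
  simp

theorem augProj_pow_apply_eq_zero {n m : ℕ} (hnm : n < m) {c : H}
    (hc : iteratedReducedComul k H n c = 0) : (augProj k H ^ m) c = 0 := by
  obtain ⟨d, rfl⟩ := Nat.exists_eq_add_of_lt hnm
  rw [add_assoc, pow_add]
  refine augProj_pow_mul_apply_eq_zero ?_ hc
  rw [pow_succ, conv_mul_one, augProj_one, mul_zero]

theorem id_pow_eq_sum_augProj_pow (m : ℕ) :
    (toConv (LinearMap.id : H →ₗ[k] H)) ^ m =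
      ∑ n ∈ Finset.range (m + 1), m.choose n • augProj k H ^ n := by
  have h : toConv (LinearMap.id : H →ₗ[k] H) = augProj k H + 1 := by simp [augProj]
  rw [h, (Commute.one_right _).add_pow]
  simp [nsmul_eq_mul, Nat.cast_comm]

theorem id_pow_apply_eq_sum (m : ℕ) (c : H) :
    (toConv (LinearMap.id : H →ₗ[k] H) ^ m) c =
      ∑ n ∈ Finset.range (m + 1), m.choose n • (augProj k H ^ n) c := by
  rw [id_pow_eq_sum_augProj_pow]
  change (WithConv.ofConv _ : H →ₗ[k] H) c = _
  rw [ofConv_sum, LinearMap.sum_apply]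
  rfl

/-- The convolution powers of the identity are multiplicative. -/
theorem id_pow_prod {ι : Type*} (m : ℕ) (s : Finset ι) (f : ι → H) :
    (toConv (LinearMap.id : H →ₗ[k] H) ^ m) (∏ i ∈ s, f i) =
      ∏ i ∈ s, (toConv (LinearMap.id : H →ₗ[k] H) ^ m) (f i) := by
  -- Commutativity of H makes algebra maps to H stable under convolution.
  have h := AlgHom.toLinearMap_convPow (toConv (AlgHom.id k H)) m
  have h' : toConv (LinearMap.id : H →ₗ[k] H) = toConv (toConv (AlgHom.id k H)).ofConv.toLinearMap :=
    rfl
  rw [h', ← h]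
  exact map_prod (toConv (AlgHom.id k H) ^ m).ofConv f s

theorem id_pow_succ_apply (m : ℕ) (c : H) :
    (toConv (LinearMap.id : H →ₗ[k] H) ^ (m + 1)) c =
      c + (toConv (LinearMap.id : H →ₗ[k] H) ^ m) c +
        LinearMap.mul' k H ((toConv (LinearMap.id : H →ₗ[k] H) ^ m).ofConv.lTensor H
          (reducedComul k H c)) := by
  have h1 : (toConv (LinearMap.id : H →ₗ[k] H) ^ m).ofConv 1 = 1 := by
    simpa using id_pow_prod (k := k) (H := H) m (∅ : Finset ℕ) (fun _ => 1)
  rw [pow_succ', LinearMap.convMul_apply, comul_eq_reducedComul_add]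
  simp only [map_add, TensorProduct.map_tmul, LinearMap.mul'_apply, h1, LinearMap.lTensor]
  simp only [LinearMap.id_apply, mul_one, one_mul]
  ring_nf

end Bialgebra

theorem antipode_apply_eq_sum [HopfAlgebra k H] {n : ℕ} {c : H}
    (hc : iteratedReducedComul k H n c = 0) :
    HopfAlgebra.antipode k c =
      ∑ m ∈ Finset.range (n + 2), ((-1) ^ m : k) • (augProj k H ^ m) c := by
  have h1 : augProj k H + 1 = toConv LinearMap.id := by simp [augProj]
  have h2 : toConv (HopfAlgebra.antipode k (A := H)) =
      ∑ m ∈ Finset.range (n + 2), (-augProj k H) ^ m +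
        (-augProj k H) ^ (n + 2) * toConv (HopfAlgebra.antipode k (A := H)) := by
    have h3 := geom_sum_mul_neg (-augProj k H) (n + 2)
    rw [sub_neg_eq_add, add_comm 1, h1] at h3
    have h4 := congrArg (· * toConv (HopfAlgebra.antipode k (A := H))) h3
    simp only [mul_assoc, LinearMap.id_mul_antipode, mul_one, sub_mul, one_mul] at h4
    rw [h4, sub_add_cancel]
  -- The first n factors J match the vanishing iterate at `c`; the spare `J ^ 2` makes the remaining
  -- factor vanish at 1, which the antipode alone does not.
  have h5 : ((-augProj k H) ^ (n + 2) * toConv (HopfAlgebra.antipode k (A := H))) c = 0 := by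
    rw [neg_pow, pow_add (augProj k H), ← Int.cast_one, ← Int.cast_neg, ← Int.cast_pow, mul_assoc,
      ← zsmul_eq_mul, mul_assoc]
    have : (augProj k H ^ n * (augProj k H ^ 2 * toConv (HopfAlgebra.antipode k (A := H)))) c = 0 :=
      augProj_pow_mul_apply_eq_zero
        (by rw [conv_mul_one, pow_two, conv_mul_one, augProj_one]; simp) hc
    change (_ • ofConv _ : H →ₗ[k] H) c = 0
    rw [LinearMap.smul_apply]
    erw [this]
    simp
  calc HopfAlgebra.antipode k c = (toConv (HopfAlgebra.antipode k (A := H))) c := rfl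
    _ = (∑ m ∈ Finset.range (n + 2), (-augProj k H) ^ m) c +
        ((-augProj k H) ^ (n + 2) * toConv (HopfAlgebra.antipode k (A := H))) c := by
      conv_lhs => rw [h2]
      rfl
    _ = _ := by
      rw [h5, add_zero]
      change (ofConv _ : H →ₗ[k] H) c = _
      rw [ofConv_sum, LinearMap.sum_apply]
      refine Finset.sum_congr rfl fun m _ => ?_
      have : (-augProj k H) ^ m = ((-1) ^ m : k) • augProj k H ^ m := by
        rw [← neg_one_smul k (augProj k H), smul_pow]
      rw [this]
      rfl

end Convolution

/-! ### Counting strictly increasing maps to a chain. -/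

section StrictMaps

variable (P : Type*) [PartialOrder P]

/-- The number of strictly increasing maps from `P` to `Fin m`. -/
noncomputable def strictCount (m : ℕ) : ℕ :=
  Nat.card {f : P → Fin m // StrictMono f}

/-- A strictly increasing map is a surjective one onto its image. -/
noncomputable def strictMonoEquivSigma [Finite P] (m : ℕ) :
    {f : P → Fin m // StrictMono f} ≃ Σ s : Finset (Fin m), Linearization P s.card where
  toFun f :=
    have := Fintype.ofFinite P
    let s := Finset.univ.image f.1
    ⟨s, fun x => (s.orderIsoOfFin rfl).symm ⟨f.1 x, by simp [s]⟩, by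
      constructor
      · intro y
        obtain ⟨x, -, hx⟩ := Finset.mem_image.1 (s.orderIsoOfFin rfl y).2
        exact ⟨x, (s.orderIsoOfFin rfl).symm_apply_eq.2 (Subtype.ext hx)⟩
      · intro x y hxy
        simpa using f.2 hxy⟩
  invFun g := ⟨fun x => g.1.orderEmbOfFin rfl (g.2.1 x),
    (g.1.orderEmbOfFin rfl).strictMono.comp g.2.2.2⟩
  left_inv f := by
    ext x
    simp [← Finset.coe_orderIsoOfFin_apply]
  right_inv g := by
    obtain ⟨s, g, hg, hg'⟩ := g
    have := Fintype.ofFinite P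
    have hs : Finset.univ.image (fun x => s.orderEmbOfFin rfl (g x)) = s := by
      ext y
      simp only [Finset.mem_image, Finset.mem_univ, true_and]
      constructor
      · rintro ⟨x, rfl⟩
        exact Finset.orderEmbOfFin_mem _ _ _
      · intro hy
        obtain ⟨x, hx⟩ := hg ((s.orderIsoOfFin rfl).symm ⟨y, hy⟩)
        exact ⟨x, by rw [hx, ← Finset.coe_orderIsoOfFin_apply]; simp⟩
    -- The type of the linearization depends on the image, so the image is generalized to a free `t`
    -- before substitution.
    have key : ∀ (t : Finset (Fin m)) (e : t = s)
        (g' : Linearization P t.card), (∀ x, t.orderEmbOfFin rfl (g'.1 x) =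
          s.orderEmbOfFin rfl (g x)) →
        (⟨t, g'⟩ : Σ s : Finset (Fin m), Linearization P s.card) = ⟨s, g, hg, hg'⟩ := by
      rintro t rfl g' h
      congr 1
      apply Subtype.ext
      funext x
      exact (t.orderEmbOfFin rfl).injective (h x)
    exact key _ (by convert hs) _ fun x => by
      rw [← Finset.coe_orderIsoOfFin_apply, OrderIso.apply_symm_apply]

theorem strictCount_eq_sum [Finite P] (m : ℕ) :
    strictCount P m =
      ∑ n ∈ Finset.range (m + 1), m.choose n * Fintype.card (Linearization P n) := by
  rw [strictCount, Nat.card_congr (strictMonoEquivSigma P m), Nat.card_eq_fintype_card,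
    Fintype.card_sigma, ← Finset.powerset_univ,
    Finset.sum_powerset_apply_card (fun n => Fintype.card (Linearization P n))]
  simp

variable {P}

theorem strictCount_zero [Nonempty P] : strictCount P 0 = 0 := by
  have : IsEmpty {f : P → Fin 0 // StrictMono f} := ⟨fun f => (f.1 (Classical.arbitrary P)).elim0⟩
  rw [strictCount, Nat.card_of_isEmpty]

theorem strictCount_of_unique [Unique P] (m : ℕ) : strictCount P m = m := by
  have h : ∀ f : P → Fin m, StrictMono f := fun f => Subsingleton.strictMono f
  rw [strictCount, Nat.card_congr (Equiv.subtypeUnivEquiv h), Nat.card_eq_fintype_card]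
  simp

/-- Elements of different summands are incomparable, so the choices are independent. -/
theorem strictCount_sigma {ι : Type*} [Fintype ι] (Q : ι → Type*) [∀ i, PartialOrder (Q i)]
    (m : ℕ) : strictCount (Σ i, Q i) m = ∏ i, strictCount (Q i) m := by
  simp only [strictCount]
  rw [← Nat.card_pi]
  refine Nat.card_congr
    { toFun f i := ⟨fun x => f.1 ⟨i, x⟩, fun x y h => f.2 (Sigma.mk_lt_mk_iff.2 h)⟩
      invFun g := ⟨fun x => (g x.1).1 x.2, ?_⟩
      left_inv f := rfl
      right_inv g := rfl }
  rintro _ _ ⟨i, x, y, h⟩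
  exact (g i).2 h

/-- A strictly increasing map on `P` with a minimum added either avoids the least value, or takes
it exactly at the minimum. -/
noncomputable def strictMonoWithBotEquiv (P : Type*) [PartialOrder P] (m : ℕ) :
    {f : WithBot P → Fin m // StrictMono f} ⊕ {f : P → Fin m // StrictMono f} ≃
      {f : WithBot P → Fin (m + 1) // StrictMono f} :=
  Equiv.ofBijective
    (Sum.elim (fun f => ⟨fun x => (f.1 x).succ, fun x y h => Fin.succ_lt_succ_iff.2 (f.2 h)⟩)
      fun f => ⟨WithBot.recBotCoe 0 fun x => (f.1 x).succ, fun x y h => by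
        induction y with
        | bot => exact absurd h not_lt_bot
        | coe y =>
          induction x with
          | bot => exact Fin.succ_pos _
          | coe x => exact Fin.succ_lt_succ_iff.2 (f.2 (WithBot.coe_lt_coe.1 h))⟩) (by
    constructor
    · rintro (f | f) (g | g) h
      · congr 1
        ext x
        have := congrFun (congrArg Subtype.val h) x
        simpa using congrArg Fin.val this
      · have := congrFun (congrArg Subtype.val h) ⊥
        exact absurd this (Fin.succ_ne_zero _)
      · have := congrFun (congrArg Subtype.val h) ⊥
        exact absurd this.symm (Fin.succ_ne_zero _)
      · congr 1
        ext x
        have := congrFun (congrArg Subtype.val h) (x : WithBot P)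
        simpa using congrArg Fin.val this
    · rintro ⟨f, hf⟩
      have hpos : ∀ x : P, f x ≠ 0 := fun x =>
        ((Fin.zero_le _).trans_lt (hf (WithBot.bot_lt_coe x))).ne'
      by_cases h0 : f ⊥ = 0
      · refine ⟨Sum.inr ⟨fun x => (f x).pred (hpos x), fun x y h =>
          Fin.pred_lt_pred_iff.2 (hf (WithBot.coe_lt_coe.2 h))⟩, ?_⟩
        apply Subtype.ext
        funext x
        induction x with
        | bot => exact h0.symm
        | coe x => exact Fin.succ_pred _ (hpos x)
      · have h : ∀ x, f x ≠ 0 := fun x => by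
          induction x with
          | bot => exact h0
          | coe x => exact hpos x
        refine ⟨Sum.inl ⟨fun x => (f x).pred (h x), fun x y hxy =>
          Fin.pred_lt_pred_iff.2 (hf hxy)⟩, ?_⟩
        apply Subtype.ext
        funext x
        exact Fin.succ_pred _ (h x))

theorem strictCount_withBot_succ [Finite P] (m : ℕ) :
    strictCount (WithBot P) (m + 1) = strictCount (WithBot P) m + strictCount P m := by
  have : Finite (WithBot P) := inferInstanceAs (Finite (Option P))
  rw [strictCount, ← Nat.card_congr (strictMonoWithBotEquiv P m), Nat.card_sum]
  rfl

end StrictMaps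

/-! ### Recursions for counts and values of trees. -/

namespace DecTree

variable {X : Type*}

instance (T : DecTree X) : Nonempty T.Vertex := by
  cases T with
  | leaf i => exact ⟨()⟩
  | node i i₀ s T => exact ⟨(⊥ : WithBot _)⟩

theorem strictCount_leaf (i : X) (m : ℕ) : strictCount (leaf i).Vertex m = m :=
  strictCount_of_unique (P := Unit) m

theorem strictCount_node_succ (i i₀ : X) (s : ℕ) (T : Fin (s + 1) → DecTree X) (m : ℕ) :
    strictCount (node i i₀ s T).Vertex (m + 1) =
      strictCount (node i i₀ s T).Vertex m + ∏ j, strictCount (T j).Vertex m := by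
  rw [← strictCount_sigma]
  exact strictCount_withBot_succ (P := Σ j, (T j).Vertex) m

section Value

variable {k V H : Type*} [Field k] [AddCommGroup V] [Module k V] [CommRing H]
  [Bialgebra k H] (ι : V →ₗ[k] H) (b : Module.Basis X k V)

theorem value_leaf (i : X) : (leaf i).value ι b = ι (b i) :=
  Fintype.prod_unique (ι := Unit) _

theorem value_node (i i₀ : X) (s : ℕ) (T : Fin (s + 1) → DecTree X) :
    (node i i₀ s T).value ι b = ι (b i₀) * ∏ j, (T j).value ι b := by
  refine (Fintype.prod_option (α := Σ j, (T j).Vertex) _).trans ?_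
  rw [Fintype.prod_sigma]
  rfl

end Value

end DecTree

/-- With the uniqueness statement that follows, this identifies nonempty multisets with sorted
families, hence monomials with possible lists of branch decorations. -/
theorem exists_monotone_map_univ_eq {X : Type*} [LinearOrder X] {I : Multiset X} (hI : I ≠ 0) :
    ∃ (s : ℕ) (a : Fin (s + 1) → X), Monotone a ∧ Finset.univ.val.map a = I := by
  obtain ⟨s, hs⟩ := Nat.exists_eq_succ_of_ne_zero (mt Multiset.card_eq_zero.1 hI)
  have hl : (I.sort (· ≤ ·)).length = s + 1 := by rw [Multiset.length_sort, hs]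
  refine ⟨s, fun j => (I.sort (· ≤ ·)).get (j.cast hl.symm), fun j j' h => ?_, ?_⟩
  · exact (Multiset.pairwise_sort I (· ≤ ·)).sortedLE.monotone_get h
  · rw [Fin.univ_val_map]
    conv_rhs => rw [← Multiset.sort_eq I (· ≤ ·)]
    congr 1
    apply List.ext_get
    · simp [hs]
    · intro n h1 h2
      simp [-List.ofFn_succ]

theorem eq_of_monotone_of_map_univ_eq {X : Type*} [LinearOrder X] {p q : Σ s : ℕ, Fin (s + 1) → X}
    (hp : Monotone p.2) (hq : Monotone q.2)
    (h : Finset.univ.val.map p.2 = Finset.univ.val.map q.2) : p = q := by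
  obtain ⟨s, a⟩ := p
  obtain ⟨t, c⟩ := q
  obtain rfl : s = t := by simpa using congrArg Multiset.card h
  simp only [Fin.univ_val_map, Multiset.coe_eq_coe] at h
  have := h.eq_of_sortedLE hp.sortedLE_ofFn hq.sortedLE_ofFn
  exact congrArg (Sigma.mk s) (List.ofFn_injective this)

/-! ### Expansion of the reduced coproduct on the basis. -/

section StructureCoeff

variable {k V H X : Type*} [Field k] [AddCommGroup V] [Module k V] [CommRing H]

theorem monomialBasis_singleton [Algebra k H] [DecidableEq X] {ι : V →ₗ[k] H}
    (h : IsSymmetricAlgebra ι) (b : Module.Basis X k V) (i : X) :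
    monomialBasis h b {i} = ι (b i) := by
  simp [monomialBasis_apply]

variable [Bialgebra k H]

theorem repr_rTensor_eq_zero [DecidableEq X] {ι : V →ₗ[k] H} (h : IsSymmetricAlgebra ι)
    (b : Module.Basis X k V) {q : Multiset X × Multiset X} (hq : ∀ i₀, q.1 ≠ {i₀}) (y : V ⊗[k] H) :
    ((monomialBasis h b).tensorProduct (monomialBasis h b)).repr (ι.rTensor H y) q = 0 := by
  have hv : (monomialBasis h b).coord q.1 ∘ₗ ι = 0 := by
    refine b.ext fun i => ?_
    simp only [LinearMap.comp_apply, Module.Basis.coord_apply, LinearMap.zero_apply]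
    rw [← monomialBasis_singleton h b, Module.Basis.repr_self,
      Finsupp.single_eq_of_ne (hq i)]
  induction y using TensorProduct.induction_on with
  | zero => simp
  | tmul v x =>
    have : (monomialBasis h b).repr (ι v) q.1 = 0 := LinearMap.congr_fun hv v
    rw [LinearMap.rTensor_tmul, Module.Basis.tensorProduct_repr_tmul_apply, this, smul_eq_mul,
      mul_zero]
  | add x y hx hy => rw [map_add, map_add, Finsupp.add_apply, hx, hy, add_zero]

theorem coord_zero_monomialBasis [DecidableEq X] {ι : V →ₗ[k] H}
    (hH : IsRightHandedPolynomial ι) (b : Module.Basis X k V) :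
    (monomialBasis hH.isSymmetricAlgebra b).coord 0 = Coalgebra.counit := by
  refine (monomialBasis hH.isSymmetricAlgebra b).ext fun I => ?_
  rw [Module.Basis.coord_apply, Module.Basis.repr_self, monomialBasis_apply]
  induction I using Multiset.induction_on with
  | empty => simp
  | cons i I _ => simp [hH.counit_ι]

theorem lTensor_counit_reducedComul {c : H} (hc : Coalgebra.counit (R := k) c = 0) :
    (Coalgebra.counit (R := k)).lTensor H (reducedComul k H c) = 0 := by
  simp [reducedComul, hc]

theorem repr_tensorProduct_zero_right {κ : Type*} [DecidableEq X] {ι : V →ₗ[k] H}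
    (hH : IsRightHandedPolynomial ι) (b : Module.Basis X k V) (c : Module.Basis κ k H) (j : κ)
    (x : H ⊗[k] H) :
    (c.tensorProduct (monomialBasis hH.isSymmetricAlgebra b)).repr x (j, 0) =
      c.coord j (TensorProduct.rid k H ((Coalgebra.counit (R := k)).lTensor H x)) := by
  induction x using TensorProduct.induction_on with
  | zero => simp
  | tmul x y =>
    have := LinearMap.congr_fun (coord_zero_monomialBasis hH b) y
    rw [Module.Basis.coord_apply] at this
    simp [this]
  | add x y hx hy => simp only [map_add, Finsupp.add_apply, hx, hy]

/-- By the counit axiom the reduced coproduct has no component b_{i₀} ⊗ 1; this is why every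
internal vertex has a branch. -/
theorem structureCoeff_zero [DecidableEq X] {ι : V →ₗ[k] H}
    (hH : IsRightHandedPolynomial ι) (b : Module.Basis X k V) (i i₀ : X) :
    structureCoeff hH.isSymmetricAlgebra b i i₀ 0 = 0 := by
  rw [structureCoeff, repr_tensorProduct_zero_right hH,
    lTensor_counit_reducedComul (hH.counit_ι _), map_zero, map_zero]

variable [LinearOrder X] {ι : V →ₗ[k] H}

theorem finite_structureCoeff_ne_zero (h : IsSymmetricAlgebra ι) (b : Module.Basis X k V) (i : X) :
    {p : X × Σ s : ℕ, Fin (s + 1) → X | Monotone p.2.2 ∧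
      structureCoeff h b i p.1 (Finset.univ.val.map p.2.2) ≠ 0}.Finite := by
  refine Set.Finite.of_finite_image (f := fun p => (({p.1}, Finset.univ.val.map p.2.2) :
    Multiset X × Multiset X)) ((((monomialBasis h b).tensorProduct (monomialBasis h b)).repr
    (reducedComul k H (ι (b i)))).support.finite_toSet.subset ?_) ?_
  · rintro _ ⟨p, hp, rfl⟩
    exact Finsupp.mem_support_iff.2 hp.2
  · rintro ⟨i₀, p⟩ hp ⟨j₀, q⟩ hq h
    simp only [Prod.mk.injEq, Multiset.singleton_inj] at h
    exact Prod.ext h.1 (eq_of_monotone_of_map_univ_eq hp.1 hq.1 h.2)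

/-- The decorations `i₀` and `i₁ ≤ ⋯ ≤ iₛ` for which the structure coefficient of `b i` does not
vanish. -/
noncomputable def structureSupport (h : IsSymmetricAlgebra ι) (b : Module.Basis X k V) (i : X) :
    Finset (X × Σ s : ℕ, Fin (s + 1) → X) :=
  (finite_structureCoeff_ne_zero h b i).toFinset

theorem mem_structureSupport {h : IsSymmetricAlgebra ι} {b : Module.Basis X k V} {i : X}
    {p : X × Σ s : ℕ, Fin (s + 1) → X} : p ∈ structureSupport h b i ↔
      Monotone p.2.2 ∧ structureCoeff h b i p.1 (Finset.univ.val.map p.2.2) ≠ 0 := by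
  simp [structureSupport]

theorem reducedComul_basis (hH : IsRightHandedPolynomial ι) (b : Module.Basis X k V) (i : X) :
    reducedComul k H (ι (b i)) = ∑ p ∈ structureSupport hH.isSymmetricAlgebra b i,
      structureCoeff hH.isSymmetricAlgebra b i p.1 (Finset.univ.val.map p.2.2) •
        ι (b p.1) ⊗ₜ[k] ∏ j, ι (b (p.2.2 j)) := by
  have h := hH.isSymmetricAlgebra
  have key := (((monomialBasis h b).tensorProduct (monomialBasis h b)).linearCombination_repr
    (reducedComul k H (ι (b i))))
  rw [Finsupp.linearCombination_apply, Finsupp.sum] at key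
  conv_lhs => rw [← key]
  symm
  refine Finset.sum_nbij (fun p => ({p.1}, Finset.univ.val.map p.2.2)) ?_ ?_ ?_ ?_
  · intro p hp
    exact Finsupp.mem_support_iff.2 (mem_structureSupport.1 hp).2
  · rintro ⟨i₀, p⟩ hp ⟨j₀, q⟩ hq h
    simp only [Prod.mk.injEq, Multiset.singleton_inj] at h
    exact Prod.ext h.1 (eq_of_monotone_of_map_univ_eq (mem_structureSupport.1 hp).1
      (mem_structureSupport.1 hq).1 h.2)
  · rintro ⟨J, I⟩ hJI
    have hne := Finsupp.mem_support_iff.1 hJI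
    obtain ⟨i₀, rfl⟩ : ∃ i₀, J = {i₀} := by
      by_contra! hJ
      obtain ⟨y, hy⟩ := hH.reducedComul_mem (b i)
      rw [← hy] at hne
      exact hne (repr_rTensor_eq_zero h b hJ y)
    have hI : I ≠ 0 := by
      rintro rfl
      exact hne (structureCoeff_zero hH b i i₀)
    obtain ⟨s, a, ha, rfl⟩ := exists_monotone_map_univ_eq hI
    exact ⟨(i₀, ⟨s, a⟩), mem_structureSupport.2 ⟨ha, hne⟩, rfl⟩
  · intro p _
    rw [Module.Basis.tensorProduct_apply, monomialBasis_singleton, monomialBasis_apply,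
      Multiset.map_map]
    rfl

open WithConv in
theorem id_pow_succ_basis (hH : IsRightHandedPolynomial ι) (b : Module.Basis X k V) (m : ℕ)
    (i : X) :
    (toConv (LinearMap.id : H →ₗ[k] H) ^ (m + 1)) (ι (b i)) =
      ι (b i) + (toConv (LinearMap.id : H →ₗ[k] H) ^ m) (ι (b i)) +
        ∑ p ∈ structureSupport hH.isSymmetricAlgebra b i,
          structureCoeff hH.isSymmetricAlgebra b i p.1 (Finset.univ.val.map p.2.2) •
            (ι (b p.1) *
              ∏ j, (toConv (LinearMap.id : H →ₗ[k] H) ^ m) (ι (b (p.2.2 j)))) := by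
  rw [id_pow_succ_apply]
  congr 1
  conv_lhs => rw [reducedComul_basis hH b i]
  simp only [map_sum, map_smul, LinearMap.lTensor_tmul, LinearMap.mul'_apply, ← id_pow_prod]

end StructureCoeff

/-! ### Summation over trees and binomial inversion. -/

namespace DecTree

open Finset

variable {k V H X : Type*} [Field k] [AddCommGroup V] [Module k V] [CommRing H]
  [Bialgebra k H] [LinearOrder X] {ι : V →ₗ[k] H}

open scoped Classical in
/-- The trees of `treesAt i` with at most `m` levels and nonzero coefficient. -/
noncomputable def boundedTrees (h : IsSymmetricAlgebra ι) (b : Module.Basis X k V) :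
    ℕ → X → Finset (DecTree X)
  | 0, _ => ∅
  | m + 1, i => insert (leaf i) (((structureSupport h b i).sigma fun p =>
      Fintype.piFinset fun j => boundedTrees h b m (p.2.2 j)).image
        fun x => node i x.1.1 x.1.2.1 x.2)

variable (h : IsSymmetricAlgebra ι) (b : Module.Basis X k V)

theorem mem_boundedTrees_succ {m : ℕ} {i : X} {T : DecTree X} :
    T ∈ boundedTrees h b (m + 1) i ↔ T = leaf i ∨ ∃ p ∈ structureSupport h b i,
      ∃ T' : Fin (p.2.1 + 1) → DecTree X, (∀ j, T' j ∈ boundedTrees h b m (p.2.2 j)) ∧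
        node i p.1 p.2.1 T' = T := by
  simp only [boundedTrees, mem_insert, mem_image, mem_sigma, Fintype.mem_piFinset, Sigma.exists,
    and_assoc, exists_and_left]

theorem boundedTrees_subset_treesAt (m : ℕ) (i : X) : ↑(boundedTrees h b m i) ⊆ treesAt i := by
  induction m generalizing i with
  | zero => simp [boundedTrees]
  | succ m ih =>
    intro T hT
    rw [mem_coe, mem_boundedTrees_succ] at hT
    obtain rfl | ⟨p, hp, T, hT, rfl⟩ := hT
    · exact ⟨trivial, rfl⟩
    · refine ⟨⟨?_, fun j => (ih _ (hT j)).1⟩, rfl⟩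
      have : (fun j => (T j).root) = p.2.2 := funext fun j => (ih _ (hT j)).2
      rw [this]
      exact (mem_structureSupport.1 hp).1

theorem boundedTrees_subset_succ (m : ℕ) (i : X) :
    boundedTrees h b m i ⊆ boundedTrees h b (m + 1) i := by
  induction m generalizing i with
  | zero => simp [boundedTrees]
  | succ m ih =>
    intro T hT
    rw [mem_boundedTrees_succ] at hT ⊢
    obtain rfl | ⟨p, hp, T, hT, rfl⟩ := hT
    · exact Or.inl rfl
    · exact Or.inr ⟨p, hp, T, fun j => ih _ (hT j), rfl⟩

theorem boundedTrees_mono {i : X} : Monotone fun m => boundedTrees h b m i :=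
  monotone_nat_of_le_succ fun m => boundedTrees_subset_succ h b m i

/-- A strict map to m values bounds the height, and a nonzero coefficient confines the decorations
at each internal vertex to a finite support. -/
theorem mem_boundedTrees {m : ℕ} {i : X} {T : DecTree X} (hT : T ∈ treesAt i)
    (hc : T.coeff h b ≠ 0) (hm : strictCount T.Vertex m ≠ 0) : T ∈ boundedTrees h b m i := by
  induction m generalizing i T with
  | zero => exact absurd strictCount_zero hm
  | succ m ih =>
    obtain ⟨hs, rfl⟩ := hT
    cases T with
    | leaf i => exact (mem_boundedTrees_succ h b).2 (Or.inl rfl)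
    | node i i₀ s T =>
      rw [strictCount_node_succ] at hm
      obtain hm | hm : strictCount (node i i₀ s T).Vertex m ≠ 0 ∨
          ∏ j, strictCount (T j).Vertex m ≠ 0 := by
        by_contra! h0
        exact hm (by rw [h0.1, h0.2])
      · exact boundedTrees_subset_succ h b m _ (ih ⟨hs, rfl⟩ hc hm)
      · rw [coeff] at hc
        rw [prod_ne_zero_iff] at hm
        exact (mem_boundedTrees_succ h b).2 (Or.inr ⟨(i₀, ⟨s, fun j => (T j).root⟩),
          mem_structureSupport.2 ⟨hs.1, left_ne_zero_of_mul hc⟩, T,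
          fun j => ih ⟨hs.2 j, rfl⟩
            (prod_ne_zero_iff.1 (right_ne_zero_of_mul hc) j (mem_univ j)) (hm j (mem_univ j)),
          rfl⟩)

theorem sum_boundedTrees_succ {M : Type*} [AddCommMonoid M] (m : ℕ) (i : X) (f : DecTree X → M) :
    ∑ T ∈ boundedTrees h b (m + 1) i, f T = f (leaf i) + ∑ p ∈ structureSupport h b i,
      ∑ T ∈ Fintype.piFinset fun j => boundedTrees h b m (p.2.2 j), f (node i p.1 p.2.1 T) := by
  classical
  rw [boundedTrees, sum_insert (by simp), sum_image, sum_sigma]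
  rintro ⟨⟨i₀, s, a⟩, T⟩ hx ⟨⟨j₀, t, c⟩, T'⟩ hy hxy
  simp only [coe_sigma, Set.mem_sigma_iff, mem_coe, Fintype.mem_piFinset] at hx hy
  simp only [node.injEq, true_and] at hxy
  obtain ⟨rfl, rfl, hT⟩ := hxy
  obtain rfl := eq_of_heq hT
  -- The decorations `a` and `c` are both read off from the roots of the same branches.
  obtain rfl : a = c := funext fun j => (boundedTrees_subset_treesAt h b _ _ (hx.2 j)).2.symm.trans
    (boundedTrees_subset_treesAt h b _ _ (hy.2 j)).2
  rfl

theorem sum_strictCount_of_le {m n : ℕ} (hmn : m ≤ n) (i : X) :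
    ∑ T ∈ boundedTrees h b m i, strictCount T.Vertex m • T.coeff h b • T.value ι b =
      ∑ T ∈ boundedTrees h b n i, strictCount T.Vertex m • T.coeff h b • T.value ι b := by
  refine sum_subset (boundedTrees_mono h b hmn) fun T hT hT' => ?_
  by_cases hc : T.coeff h b = 0
  · rw [hc, zero_smul, smul_zero]
  · have : strictCount T.Vertex m = 0 := by
      by_contra hm
      exact hT' (mem_boundedTrees h b (boundedTrees_subset_treesAt h b _ _ hT) hc hm)
    rw [this, zero_smul]

open WithConv in
/-- The convolution powers of the identity, expanded over the trees and their strictly increasing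
maps to a chain. -/
theorem id_pow_basis_eq_sum (hH : IsRightHandedPolynomial ι) (m : ℕ) (i : X) :
    (toConv (LinearMap.id : H →ₗ[k] H) ^ m) (ι (b i)) =
      ∑ T ∈ boundedTrees hH.isSymmetricAlgebra b m i,
        strictCount T.Vertex m • T.coeff hH.isSymmetricAlgebra b • T.value ι b := by
  induction m generalizing i with
  | zero => simp [boundedTrees, hH.counit_ι]
  | succ m ih =>
    -- The level-m sum is moved to trees of level m + 1 so that both sides split over the same
    -- roots.
    rw [id_pow_succ_basis hH, ih, sum_strictCount_of_le _ _ m.le_succ, sum_boundedTrees_succ,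
      sum_boundedTrees_succ, ← add_assoc, add_assoc, ← sum_add_distrib]
    simp only [strictCount_leaf, coeff, value_leaf, one_smul]
    congr 1
    · rw [succ_nsmul']
    refine sum_congr rfl fun p _ => ?_
    simp only [ih]
    -- A product of sums over branches becomes a sum over families of branches.
    rw [prod_univ_sum, mul_sum, smul_sum, ← sum_add_distrib]
    refine sum_congr rfl fun T hT => ?_
    have hroot : (fun j => (T j).root) = p.2.2 := funext fun j =>
      (boundedTrees_subset_treesAt _ b _ _ (Fintype.mem_piFinset.1 hT j)).2
    rw [strictCount_node_succ, add_smul, hroot, value_node]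
    congr 1
    simp only [Algebra.smul_def, prod_mul_distrib, map_mul, map_prod]
    ring

section Linearization

variable {h} {i : X}

theorem strictCount_ne_zero {P : Type*} [PartialOrder P] [Finite P] {n : ℕ}
    (f : Linearization P n) : strictCount P n ≠ 0 := by
  have : Nonempty {f : P → Fin n // StrictMono f} := ⟨⟨f.1, f.2.2⟩⟩
  exact Nat.card_pos.ne'

theorem mem_boundedTrees_of_linearization {n : ℕ} {T : DecTree X} (hT : T ∈ treesAt i)
    (hc : T.coeff h b ≠ 0) (f : Linearization T.Vertex n) : T ∈ boundedTrees h b n i :=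
  mem_boundedTrees h b hT hc (strictCount_ne_zero f)

/-- The bound `N` is free so that different n can share one finite set of trees; `c` accommodates
the signs of the antipode formula. -/
theorem finsum_linearization_eq_sum {n N : ℕ} (hn : n ≤ N) (c : k) :
    ∑ᶠ T ∈ treesAt i, ∑ _f : Linearization T.Vertex n, (c * T.coeff h b) • T.value ι b =
      c • ∑ T ∈ boundedTrees h b N i,
        Fintype.card (Linearization T.Vertex n) • T.coeff h b • T.value ι b := by
  rw [finsum_mem_eq_sum_of_subset _ _ (boundedTrees_subset_treesAt h b N i), smul_sum]
  · refine sum_congr rfl fun T _ => ?_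
    rw [sum_const, card_univ, mul_smul, smul_comm]
  · rintro T ⟨hT, hT'⟩
    obtain ⟨f, -, hf⟩ := exists_ne_zero_of_sum_ne_zero hT'
    refine boundedTrees_mono h b hn (mem_boundedTrees_of_linearization b hT (fun hc => ?_) f)
    rw [hc, mul_zero, zero_smul] at hf
    exact hf rfl

-- Both sides solve the same unitriangular system of binomial relations: the terms below n cancel by
-- induction, and the term at n has coefficient 1.
open WithConv in
theorem augProj_pow_basis (hH : IsRightHandedPolynomial ι) {n N : ℕ} (hn : n ≤ N) :
    (augProj k H ^ n) (ι (b i)) = ∑ T ∈ boundedTrees hH.isSymmetricAlgebra b N i,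
      Fintype.card (Linearization T.Vertex n) • T.coeff hH.isSymmetricAlgebra b • T.value ι b := by
  induction n using Nat.strong_induction_on generalizing N with
  | _ n ih =>
    have h1 := id_pow_apply_eq_sum (k := k) n (ι (b i))
    rw [id_pow_basis_eq_sum b hH] at h1
    simp only [strictCount_eq_sum, sum_smul, mul_smul] at h1
    rw [sum_comm, sum_range_succ, sum_range_succ, ← smul_sum] at h1
    have h2 : ∀ m ∈ range n, n.choose m • (augProj k H ^ m) (ι (b i)) =
        ∑ T ∈ boundedTrees hH.isSymmetricAlgebra b n i, n.choose m •
          Fintype.card (Linearization T.Vertex m) •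
            T.coeff hH.isSymmetricAlgebra b • T.value ι b := fun m hm => by
      rw [ih m (mem_range.1 hm) (mem_range.1 hm).le, smul_sum]
    rw [sum_congr rfl h2, add_right_inj, Nat.choose_self, one_smul, one_smul] at h1
    rw [← h1]
    -- The sums at levels n and N agree because both equal the sum over all trees.
    simpa using (finsum_linearization_eq_sum (h := hH.isSymmetricAlgebra) (i := i) b le_rfl
      (1 : k)).symm.trans (finsum_linearization_eq_sum b hn 1)

open WithConv in
theorem finsum_linearization_eq_augProj_pow (hH : IsRightHandedPolynomial ι) (n : ℕ) (c : k) :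
    ∑ᶠ T ∈ treesAt i, ∑ _f : Linearization T.Vertex n,
      (c * T.coeff hH.isSymmetricAlgebra b) • T.value ι b =
        c • (augProj k H ^ n) (ι (b i)) := by
  rw [finsum_linearization_eq_sum b le_rfl, augProj_pow_basis b hH le_rfl]

end Linearization

end DecTree

end PreLieForest

/-! ### The two formulas. -/

theorem mainTheorem5 {k V H X : Type*} [Field k] [CharZero k] [AddCommGroup V] [Module k V]
    [CommRing H] [HopfAlgebra k H] [LinearOrder X]
    (ι : V →ₗ[k] H) (hH : PreLieForest.IsRightHandedPolynomial ι)
    (hconil : PreLieForest.IsConilpotent k H) (b : Module.Basis X k V) (i : X) :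
    (∀ n : ℕ, 1 ≤ n →
      {T ∈ PreLieForest.DecTree.treesAt i |
        T.coeff hH.isSymmetricAlgebra b ≠ 0 ∧
          Nonempty (PreLieForest.Linearization T.Vertex n)}.Finite ∧
      ((WithConv.toConv (LinearMap.id : H →ₗ[k] H) - 1) ^ n).ofConv (ι (b i)) =
        ∑ᶠ T ∈ PreLieForest.DecTree.treesAt i,
          ∑ _f : PreLieForest.Linearization T.Vertex n,
            T.coeff hH.isSymmetricAlgebra b • T.value ι b) ∧
    {n : ℕ | 1 ≤ n ∧
      (∑ᶠ T ∈ PreLieForest.DecTree.treesAt i,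
        ∑ _f : PreLieForest.Linearization T.Vertex n,
          ((-1) ^ n * T.coeff hH.isSymmetricAlgebra b) • T.value ι b) ≠ 0}.Finite ∧
    HopfAlgebra.antipode k (ι (b i)) =
      ∑ᶠ (n : ℕ) (_ : 1 ≤ n),
        ∑ᶠ T ∈ PreLieForest.DecTree.treesAt i,
          ∑ _f : PreLieForest.Linearization T.Vertex n,
            ((-1) ^ n * T.coeff hH.isSymmetricAlgebra b) • T.value ι b := by
  have hpow := PreLieForest.DecTree.finsum_linearization_eq_augProj_pow (i := i) b hH
  obtain ⟨N, hN⟩ := hconil (ι (b i)) (hH.counit_ι _)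
  -- The geometric series starts at exponent 0, the stated sum at 1; the difference is ε(b_i) = 0.
  have hzero : (PreLieForest.augProj k H ^ 0) (ι (b i)) = 0 := by simp [hH.counit_ι]
  refine ⟨fun n _ => ⟨?_, ?_⟩, ?_, ?_⟩
  · refine (PreLieForest.DecTree.boundedTrees hH.isSymmetricAlgebra b n i).finite_toSet.subset ?_
    rintro T ⟨hT, hc, ⟨f⟩⟩
    exact PreLieForest.DecTree.mem_boundedTrees_of_linearization b hT hc f
  · simpa using (hpow n 1).symm
  · simp only [hpow]
    refine (Set.finite_Iic N).subset fun n hn => ?_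
    by_contra hn'
    exact hn.2 (by
      rw [PreLieForest.augProj_pow_apply_eq_zero (not_le.1 hn') hN, smul_zero])
  · simp only [hpow]
    rw [PreLieForest.antipode_apply_eq_sum hN, Finset.range_eq_Ico,
      Finset.sum_eq_sum_Ico_succ_bot (by omega), hzero, smul_zero, zero_add]
    symm
    refine finsum_mem_eq_sum_of_subset (s := {n | 1 ≤ n}) _ ?_ ?_
    · rintro n ⟨hn, hn'⟩
      rw [Finset.coe_Ico]
      refine ⟨hn, ?_⟩
      by_contra h
      exact hn' (by
        change _ • (PreLieForest.augProj k H ^ n) (ι (b i)) = 0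
        rw [PreLieForest.augProj_pow_apply_eq_zero (by omega) hN, smul_zero])
    · intro n hn
      exact (Finset.mem_Ico.1 (Finset.mem_coe.1 hn)).1
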